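/- For polynomials $f,g\in\mathbb{C}[z]$ let $\langle f,g\rangle:=\langle f,g\rangle_{\rm r}+\langle f,g\rangle_{\rm c}$, where $$\langle f,g\rangle_{\rm r}:=\int_{-\infty}^{\infty}dx\int_{-\infty}^{\infty}dy\; e^{-(x^2+y^2)/2}\,f(x)\,g(y)\,{\rm sgn}(y-x),$$ $$\langle f,g\rangle_{\rm c}:=2i\int_{-\infty}^{\infty}dx\int_{0}^{\infty}dy\; e^{y^2-x^2}\,{\rm erfc}\big(\sqrt{2}\,y\big)\,\big[f(x+iy)\,g(x-iy)-g(x+iy)\,f(x-iy)\big],$$ with ${\rm erfc}(x)=\frac{2}{\sqrt\pi}\int_x^\infty e^{-t^2}\,dt$; both double integrals converge absolutely. (This is the case $\tau=0$, the real Ginibre case, of the skew inner product $\langle f,g\rangle_{\rm r}=\int_{-\infty}^{\infty}dx\int_{-\infty}^{\infty}dy\,e^{-(x^2+y^2)/(2(1+\tau))}f(x)g(y)\,{\rm sgn}(y-x)$, $\langle f,g\rangle_{\rm c}=2i\int_{-\infty}^{\infty}dx\int_0^\infty dy\,e^{(y^2-x^2)/(1+\tau)}\,{\rm erfc}\big(\sqrt{2/(1-\tau^2)}\,y\big)[f(x+iy)g(x-iy)-g(x+iy)f(x-iy)]$.)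 Define $p_{2n}(z)=z^{2n}$ and $p_{2n+1}(z)=z^{2n+1}-2n\,z^{2n-1}$ for $n=0,1,2,\dots$ (so $p_1(z)=z$). Then each $p_j$ is monic of degree $j$, and the family $\{p_j\}_{j\ge 0}$ is skew orthogonal with respect to $\langle\cdot,\cdot\rangle$, that is, $$\langle p_{2j},p_{2k}\rangle=\langle p_{2j+1},p_{2k+1}\rangle=0\quad(j,k\ge 0),\qquad \langle p_{2j},p_{2k+1}\rangle=0\quad(j,k\ge 0,\ j\neq k),$$ while $\langle p_{2j},p_{2j+1}\rangle\neq 0$ for all $j\ge0$. The normalization is $$u_n:=\langle p_{2n},p_{2n+1}\rangle=(2n)!\,2\sqrt{2\pi}\qquad(n\ge 0).$$ -/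

import Mathlib

open scoped Polynomial

noncomputable section

/-- The complementary error function `erfc x = (2 / √π) ∫_x^∞ exp (-t²) dt`. -/
def erfc (x : ℝ) : ℝ :=
  2 / Real.sqrt Real.pi * ∫ t in Set.Ioi x, Real.exp (-t ^ 2)

/-- The integrand of the real part of the skew inner product:
`exp (-(x² + y²) / (2 (1 + τ))) f(x) g(y) sgn(y - x)`. -/
def realIntegrand (τ : ℝ) (f g : ℂ[X]) (x y : ℝ) : ℂ :=
  (Real.exp (-(x ^ 2 + y ^ 2) / (2 * (1 + τ))) : ℂ) * f.eval (x : ℂ) * g.eval (y : ℂ)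
    * (Real.sign (y - x) : ℂ)

/-- The integrand of the complex part of the skew inner product:
`exp ((y² - x²) / (1 + τ)) erfc(√(2 / (1 - τ²)) y)
  [f(x + iy) g(x - iy) - g(x + iy) f(x - iy)]`. -/
def complexIntegrand (τ : ℝ) (f g : ℂ[X]) (x y : ℝ) : ℂ :=
  (Real.exp ((y ^ 2 - x ^ 2) / (1 + τ)) : ℂ) * (erfc (Real.sqrt (2 / (1 - τ ^ 2)) * y) : ℂ)
    * (f.eval ((x : ℂ) + Complex.I * (y : ℂ)) * g.eval ((x : ℂ) - Complex.I * (y : ℂ))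
      - g.eval ((x : ℂ) + Complex.I * (y : ℂ)) * f.eval ((x : ℂ) - Complex.I * (y : ℂ)))

/-- The real part `⟨f, g⟩_r` of the skew inner product. -/
def skewInnerReal (τ : ℝ) (f g : ℂ[X]) : ℂ :=
  ∫ x : ℝ, ∫ y : ℝ, realIntegrand τ f g x y

/-- The complex part `⟨f, g⟩_c` of the skew inner product. -/
def skewInnerComplex (τ : ℝ) (f g : ℂ[X]) : ℂ :=
  2 * Complex.I * ∫ x : ℝ, ∫ y in Set.Ioi (0 : ℝ), complexIntegrand τ f g x y

/-- The skew inner product `⟨f, g⟩ = ⟨f, g⟩_r + ⟨f, g⟩_c`. -/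
def skewInner (τ : ℝ) (f g : ℂ[X]) : ℂ :=
  skewInnerReal τ f g + skewInnerComplex τ f g

/-- Both double integrals in the definition of `⟨f, g⟩` converge absolutely
(so that the Bochner integrals above do not take a default value). -/
def SkewInnerConverges (τ : ℝ) (f g : ℂ[X]) : Prop :=
  MeasureTheory.Integrable (fun z : ℝ × ℝ => realIntegrand τ f g z.1 z.2) ∧
  MeasureTheory.IntegrableOn (fun z : ℝ × ℝ => complexIntegrand τ f g z.1 z.2)
    (Set.univ ×ˢ Set.Ioi (0 : ℝ))

/-- Skew orthogonality of a family `p_0, p_1, …` with respect to a form `B`. -/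
def IsSkewOrthogonal (B : ℂ[X] → ℂ[X] → ℂ) (p : ℕ → ℂ[X]) : Prop :=
  (∀ j k : ℕ, B (p (2 * j)) (p (2 * k)) = 0) ∧
  (∀ j k : ℕ, B (p (2 * j + 1)) (p (2 * k + 1)) = 0) ∧
  (∀ j k : ℕ, j ≠ k → B (p (2 * j)) (p (2 * k + 1)) = 0) ∧
  (∀ j : ℕ, B (p (2 * j)) (p (2 * j + 1)) ≠ 0)

end

/-! The operator `gaussDeriv` sends h to exp(z²/2) d/dz [exp(-z²/2) h], and p_{2n+1} is
-`gaussDeriv` (X^{2n}). For g = -`gaussDeriv` h both halves of ⟨f, g⟩ can be integrated by parts. In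
the real half the jump of sgn leaves 2∫ exp(-x²) f h (`skewInnerReal_neg_gaussDeriv`). In the
complex half the line y = 0 contributes the negative of this, and differentiating erfc leaves a
planar Gaussian integral (`skewInnerComplex_neg_gaussDeriv`). The line terms cancel, so by
`skewInner_neg_gaussDeriv` the form becomes 2√(2/π) ∫_ℂ exp(-|z|²) f(z) h(z̄). Monomials are
orthogonal for it, z^n having square norm π n! before the prefactor. This settles the even-odd
pairings; pairings of equal parity vanish by reflection. -/

open MeasureTheory Filter

/-! ### The complementary error function. -/

theorem integrable_exp_neg_sq : Integrable fun t : ℝ => Real.exp (-t ^ 2) := by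
  simpa using integrable_exp_neg_mul_sq (b := 1) one_pos

theorem integral_exp_neg_sq : ∫ t : ℝ, Real.exp (-t ^ 2) = √Real.pi := by
  simpa using integral_gaussian 1

theorem erfc_eq_one_sub (x : ℝ) :
    erfc x = 1 - 2 / √Real.pi * ∫ t in (0 : ℝ)..x, Real.exp (-t ^ 2) := by
  have h := intervalIntegral.integral_interval_add_Ioi (a := 0) (b := x)
    integrable_exp_neg_sq.integrableOn integrable_exp_neg_sq.integrableOn
  have h0 : ∫ t in Set.Ioi (0 : ℝ), Real.exp (-t ^ 2) = √Real.pi / 2 := by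
    simpa using integral_gaussian_Ioi 1
  have hpi : √Real.pi ≠ 0 := by positivity
  rw [h0] at h
  rw [erfc, eq_sub_of_add_eq' h]
  field_simp

theorem hasDerivAt_erfc (x : ℝ) :
    HasDerivAt erfc (-(2 / √Real.pi * Real.exp (-x ^ 2))) x := by
  have hc : Continuous fun t : ℝ => Real.exp (-t ^ 2) := by fun_prop
  have h := ((hc.integral_hasStrictDerivAt 0 x).hasDerivAt.const_mul (2 / √Real.pi)).const_sub 1
  exact h.congr_of_eventuallyEq (Eventually.of_forall erfc_eq_one_sub)

theorem continuous_erfc : Continuous erfc :=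
  continuous_iff_continuousAt.mpr fun x => (hasDerivAt_erfc x).continuousAt

theorem erfc_zero : erfc 0 = 1 := by simp [erfc_eq_one_sub]

theorem erfc_nonneg (x : ℝ) : 0 ≤ erfc x :=
  mul_nonneg (by positivity) (integral_nonneg fun _ => (Real.exp_pos _).le)

/-- Since t² ≥ x² + (t - x)² for t ≥ x ≥ 0, a shifted Gaussian dominates. At √2 y the bound is 2
exp(-2y²), which beats the growing weight exp(y²). -/
theorem erfc_le_two_mul_exp {x : ℝ} (hx : 0 ≤ x) : erfc x ≤ 2 * Real.exp (-x ^ 2) := by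
  have hi : Integrable fun t : ℝ => Real.exp (-x ^ 2) * Real.exp (-(t - x) ^ 2) :=
    (integrable_exp_neg_sq.comp_sub_right x).const_mul _
  have h : ∫ t in Set.Ioi x, Real.exp (-t ^ 2) ≤ Real.exp (-x ^ 2) * √Real.pi := by
    calc ∫ t in Set.Ioi x, Real.exp (-t ^ 2)
        ≤ ∫ t in Set.Ioi x, Real.exp (-x ^ 2) * Real.exp (-(t - x) ^ 2) := by
          refine setIntegral_mono_on integrable_exp_neg_sq.integrableOn hi.integrableOn
            measurableSet_Ioi fun t ht => ?_
          rw [← Real.exp_add, Real.exp_le_exp]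
          nlinarith [mul_nonneg hx (sub_nonneg.mpr (Set.mem_Ioi.mp ht).le)]
      _ ≤ ∫ t, Real.exp (-x ^ 2) * Real.exp (-(t - x) ^ 2) :=
          setIntegral_le_integral hi (Eventually.of_forall fun t => by positivity)
      _ = _ := by
          rw [integral_const_mul, integral_sub_right_eq_self (fun t => Real.exp (-t ^ 2)) x,
            integral_exp_neg_sq]
  have hpi : √Real.pi ≠ 0 := by positivity
  calc erfc x ≤ 2 / √Real.pi * (Real.exp (-x ^ 2) * √Real.pi) :=
        mul_le_mul_of_nonneg_left h (by positivity)
    _ = _ := by field_simp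

/-! ### Absolute convergence of Gaussian integrals. -/

theorem integral_norm_pow_mul_exp_neg_norm_sq (n : ℕ) :
    ∫ z : ℂ, ‖z‖ ^ n * Real.exp (-‖z‖ ^ 2) = Real.pi * Real.Gamma ((n + 2) / 2) := by
  have h := Complex.integral_rpow_mul_exp_neg_rpow (p := 2) (q := n) (by norm_num)
    (by have := n.cast_nonneg (α := ℝ); linarith)
  simp only [Real.rpow_natCast, Real.rpow_ofNat] at h
  rw [h]; ring

theorem integrable_norm_pow_mul_exp_neg_norm_sq (n : ℕ) :
    Integrable fun z : ℂ => ‖z‖ ^ n * Real.exp (-‖z‖ ^ 2) := by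
  -- The integral of a non-integrable function defaults to 0, so a nonzero value proves
  -- integrability.
  apply Integrable.of_integral_ne_zero
  rw [integral_norm_pow_mul_exp_neg_norm_sq]
  have := Real.Gamma_pos_of_pos (s := ((n : ℝ) + 2) / 2) (by positivity)
  positivity

theorem integrable_eval_mul_eval_conj (f g : ℂ[X]) :
    Integrable fun z : ℂ => (Real.exp (-‖z‖ ^ 2) : ℂ)
      * (f.eval z * g.eval (starRingEnd ℂ z)) := by
  induction f using Polynomial.induction_on' with
  | add p q hp hq => exact (hp.add hq).congr (Eventually.of_forall fun z => by simp [add_mul, mul_add])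
  | monomial n a =>
    induction g using Polynomial.induction_on' with
    | add p q hp hq => exact (hp.add hq).congr (Eventually.of_forall fun z => by simp [mul_add])
    | monomial m b =>
      refine ((integrable_norm_pow_mul_exp_neg_norm_sq (n + m)).const_mul (‖a‖ * ‖b‖)).mono'
        (Continuous.aestronglyMeasurable (by fun_prop)) (Eventually.of_forall fun z => ?_)
      simp only [Polynomial.eval_monomial, norm_mul, norm_pow, RCLike.norm_conj,
        Complex.norm_real, Real.norm_eq_abs, Real.abs_exp]
      exact le_of_eq (by ring)

theorem integrable_exp_neg_mul_sq_mul_eval {b : ℝ} (hb : 0 < b) (f : ℂ[X]) :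
    Integrable fun x : ℝ => (Real.exp (-b * x ^ 2) : ℂ) * f.eval (x : ℂ) := by
  induction f using Polynomial.induction_on' with
  | add p q hp hq => exact (hp.add hq).congr (Eventually.of_forall fun z => by simp [mul_add])
  | monomial n a =>
    have h := (integrable_rpow_mul_exp_neg_mul_sq hb (s := n)
      (by have := n.cast_nonneg (α := ℝ); linarith)).ofReal (𝕜 := ℂ)
    convert! h.const_mul a using 2 with x
    simp only [Real.rpow_natCast, Polynomial.eval_monomial, RCLike.ofReal_mul,
      RCLike.ofReal_pow, Complex.coe_algebraMap]
    ring

theorem measurable_sign_real : Measurable Real.sign := by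
  unfold Real.sign
  exact Measurable.ite measurableSet_Iio measurable_const
    (Measurable.ite measurableSet_Ioi measurable_const measurable_const)

theorem norm_sign_le_one (x : ℝ) : ‖(Real.sign x : ℂ)‖ ≤ 1 := by
  rcases Real.sign_apply_eq x with h | h | h <;> simp [h]

theorem integrable_realIntegrand (f g : ℂ[X]) :
    Integrable fun z : ℝ × ℝ => realIntegrand 0 f g z.1 z.2 := by
  have h := (integrable_exp_neg_mul_sq_mul_eval (b := 1 / 2) (by norm_num) f).mul_prod
    (integrable_exp_neg_mul_sq_mul_eval (b := 1 / 2) (by norm_num) g)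
  have hs : AEStronglyMeasurable (fun z : ℝ × ℝ => (Real.sign (z.2 - z.1) : ℂ)) :=
    (Complex.measurable_ofReal.comp (measurable_sign_real.comp
      (measurable_snd.sub measurable_fst))).aestronglyMeasurable
  refine (h.bdd_mul hs (Eventually.of_forall fun z => norm_sign_le_one _)).congr
    (Eventually.of_forall fun z => ?_)
  have he : -(z.1 ^ 2 + z.2 ^ 2) / (2 * (1 + 0)) = -(1 / 2) * z.1 ^ 2 + -(1 / 2) * z.2 ^ 2 := by
    ring
  simp only [realIntegrand, he, Real.exp_add]
  push_cast
  ring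

theorem integrable_eval_mul_eval_prod (f g : ℂ[X]) :
    Integrable fun p : ℝ × ℝ => (Real.exp (-(p.1 ^ 2 + p.2 ^ 2)) : ℂ)
      * (f.eval ((p.1 : ℂ) + Complex.I * p.2) * g.eval ((p.1 : ℂ) - Complex.I * p.2)) := by
  have h := (Complex.volume_preserving_equiv_real_prod.symm.integrable_comp_emb
    Complex.measurableEquivRealProd.symm.measurableEmbedding).mpr
    (integrable_eval_mul_eval_conj f g)
  refine h.congr (Eventually.of_forall fun p => ?_)
  have h1 : ((⟨p.1, p.2⟩ : ℂ)) = (p.1 : ℂ) + Complex.I * p.2 := by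
    apply Complex.ext <;> simp
  have h2 : (starRingEnd ℂ) (⟨p.1, p.2⟩ : ℂ) = (p.1 : ℂ) - Complex.I * p.2 := by
    apply Complex.ext <;> simp
  have h3 : ‖(⟨p.1, p.2⟩ : ℂ)‖ ^ 2 = p.1 ^ 2 + p.2 ^ 2 := by
    rw [Complex.sq_norm, Complex.normSq_mk]; ring
  simp only [Function.comp_apply, Complex.measurableEquivRealProd_symm_apply, h2, h3]
  rw [h1]

/-! ### The planar density, its derivatives and its integrability. -/

/-- The planar density `exp (y² - x²) f(x + iy) g(x - iy)`. -/
noncomputable def gaussPair (f g : ℂ[X]) (x y : ℝ) : ℂ :=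
  (Real.exp (y ^ 2 - x ^ 2) : ℂ) *
    (f.eval ((x : ℂ) + Complex.I * y) * g.eval ((x : ℂ) - Complex.I * y))

/-- The operator `f ↦ f' - X f`, conjugate to `d/dz` by the weight `exp (-z² / 2)`. -/
noncomputable def gaussDeriv (f : ℂ[X]) : ℂ[X] := Polynomial.derivative f - Polynomial.X * f

/-- Because y² - x² = -(z² + z̄²)/2, the density factors as [exp(-z²/2) f(z)] · [exp(-z̄²/2) g(z̄)],
and each derivative is a product rule in z and z̄. -/
theorem hasDerivAt_gaussPair_fst (f g : ℂ[X]) (x y : ℝ) :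
    HasDerivAt (fun x => gaussPair f g x y)
      (gaussPair (gaussDeriv f) g x y + gaussPair f (gaussDeriv g) x y) x := by
  have he : HasDerivAt (fun x : ℝ => y ^ 2 - x ^ 2) (-(2 * x)) x := by
    simpa using (hasDerivAt_pow 2 x).const_sub (y ^ 2)
  have hx : HasDerivAt (fun x : ℝ => (x : ℂ)) 1 x := Complex.ofRealCLM.hasDerivAt
  have hf := (f.hasDerivAt ((x : ℂ) + Complex.I * y)).comp x (hx.add_const (Complex.I * (y : ℂ)))
  have hg := (g.hasDerivAt ((x : ℂ) - Complex.I * y)).comp x (hx.sub_const (Complex.I * (y : ℂ)))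
  refine (he.exp.ofReal_comp.mul (hf.mul hg)).congr_deriv ?_
  simp only [gaussPair, gaussDeriv, Polynomial.eval_sub, Polynomial.eval_mul, Polynomial.eval_X,
    Function.comp_apply, Pi.mul_apply]
  push_cast
  ring

theorem hasDerivAt_gaussPair_snd (f g : ℂ[X]) (x y : ℝ) :
    HasDerivAt (fun y => gaussPair f g x y)
      (Complex.I * (gaussPair (gaussDeriv f) g x y - gaussPair f (gaussDeriv g) x y)) y := by
  have he : HasDerivAt (fun y : ℝ => y ^ 2 - x ^ 2) (2 * y) y := by
    simpa using (hasDerivAt_pow 2 y).sub_const (x ^ 2)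
  have hy : HasDerivAt (fun y : ℝ => Complex.I * (y : ℂ)) (Complex.I * 1) y :=
    (Complex.ofRealCLM.hasDerivAt (x := y)).const_mul Complex.I
  have hf := (f.hasDerivAt ((x : ℂ) + Complex.I * y)).comp y (hy.const_add (x : ℂ))
  have hg := (g.hasDerivAt ((x : ℂ) - Complex.I * y)).comp y (hy.const_sub (x : ℂ))
  refine (he.exp.ofReal_comp.mul (hf.mul hg)).congr_deriv ?_
  simp only [gaussPair, gaussDeriv, Polynomial.eval_sub, Polynomial.eval_mul, Polynomial.eval_X,
    Function.comp_apply, Pi.mul_apply]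
  push_cast
  linear_combination (2 * (y : ℂ)) * (Complex.exp (y ^ 2 - x ^ 2) *
    (f.eval ((x : ℂ) + Complex.I * y) * g.eval ((x : ℂ) - Complex.I * y))) * Complex.I_sq

theorem continuous_gaussPair (f g : ℂ[X]) :
    Continuous fun z : ℝ × ℝ => gaussPair f g z.1 z.2 := by
  unfold gaussPair; fun_prop

theorem exp_mul_gaussPair (f g : ℂ[X]) (x y : ℝ) :
    (Real.exp (-(√2 * y) ^ 2) : ℂ) * gaussPair f g x y =
      (Real.exp (-(x ^ 2 + y ^ 2)) : ℂ)
      * (f.eval ((x : ℂ) + Complex.I * y) * g.eval ((x : ℂ) - Complex.I * y)) := by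
  rw [gaussPair, ← mul_assoc, ← Complex.ofReal_mul, ← Real.exp_add, mul_pow,
    Real.sq_sqrt (by norm_num)]
  ring_nf

theorem integrable_exp_mul_gaussPair (f g : ℂ[X]) :
    Integrable fun z : ℝ × ℝ => (Real.exp (-(√2 * z.2) ^ 2) : ℂ) * gaussPair f g z.1 z.2 := by
  simpa only [exp_mul_gaussPair] using integrable_eval_mul_eval_prod f g

theorem volume_prod_restrict_Ioi :
    (volume : Measure ℝ).prod (volume.restrict (Set.Ioi (0 : ℝ))) =
      (volume : Measure (ℝ × ℝ)).restrict (Set.univ ×ˢ Set.Ioi (0 : ℝ)) := by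
  rw [Measure.volume_eq_prod, ← Measure.prod_restrict, Measure.restrict_univ]

theorem integrable_exp_mul_gaussPair_upper (f g : ℂ[X]) :
    Integrable (fun z : ℝ × ℝ => (Real.exp (-(√2 * z.2) ^ 2) : ℂ) * gaussPair f g z.1 z.2)
      (volume.prod (volume.restrict (Set.Ioi 0))) := by
  rw [volume_prod_restrict_Ioi]
  exact (integrable_exp_mul_gaussPair f g).integrableOn

theorem integrable_erfc_mul_gaussPair (f g : ℂ[X]) :
    Integrable (fun z : ℝ × ℝ => (erfc (√2 * z.2) : ℂ) * gaussPair f g z.1 z.2)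
      (volume.prod (volume.restrict (Set.Ioi 0))) := by
  refine ((integrable_exp_mul_gaussPair_upper f g).norm.const_mul 2).mono'
    (Continuous.aestronglyMeasurable ?_) ?_
  · exact (Complex.continuous_ofReal.comp (continuous_erfc.comp (by fun_prop))).mul
      (continuous_gaussPair f g)
  · rw [volume_prod_restrict_Ioi]
    refine ae_restrict_of_forall_mem (MeasurableSet.univ.prod measurableSet_Ioi) fun z hz => ?_
    have hy : 0 ≤ √2 * z.2 := mul_nonneg (Real.sqrt_nonneg 2) (le_of_lt hz.2)
    rw [norm_mul, norm_mul, ← mul_assoc, Complex.norm_real, Complex.norm_real, Real.norm_eq_abs,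
      Real.norm_eq_abs, abs_of_nonneg (erfc_nonneg _), Real.abs_exp]
    exact mul_le_mul_of_nonneg_right (erfc_le_two_mul_exp hy) (norm_nonneg _)

theorem complexIntegrand_zero_eq (f g : ℂ[X]) (x y : ℝ) :
    complexIntegrand 0 f g x y =
      (erfc (√2 * y) : ℂ) * gaussPair f g x y - (erfc (√2 * y) : ℂ) * gaussPair g f x y := by
  simp only [complexIntegrand, gaussPair]
  norm_num
  ring

theorem skewInnerConverges_zero (f g : ℂ[X]) : SkewInnerConverges 0 f g := by
  refine ⟨integrable_realIntegrand f g, ?_⟩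
  rw [IntegrableOn, ← volume_prod_restrict_Ioi]
  simp only [complexIntegrand_zero_eq]
  exact (integrable_erfc_mul_gaussPair f g).sub (integrable_erfc_mul_gaussPair g f)

theorem gaussPair_neg_left (f g : ℂ[X]) (x y : ℝ) :
    gaussPair (-f) g x y = -gaussPair f g x y := by simp [gaussPair]

theorem gaussPair_neg_right (f g : ℂ[X]) (x y : ℝ) :
    gaussPair f (-g) x y = -gaussPair f g x y := by simp [gaussPair]

theorem gaussPair_neg_snd (f g : ℂ[X]) (x y : ℝ) :
    gaussPair f g x (-y) = gaussPair g f x y := by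
  simp only [gaussPair, Complex.ofReal_neg, neg_sq, mul_neg, sub_neg_eq_add, ← sub_eq_add_neg]
  ring

theorem gaussPair_zero_snd (f g : ℂ[X]) (x : ℝ) :
    gaussPair f g x 0 = (Real.exp (-x ^ 2) : ℂ) * (f.eval (x : ℂ) * g.eval (x : ℂ)) := by
  simp [gaussPair]

/-! ### Integration by parts in the real and complex halves. -/

theorem integral_deriv_mul_sign {F F' : ℝ → ℂ} (hF : ∀ y, HasDerivAt F (F' y) y)
    (hi : Integrable F) (hi' : Integrable F') (x : ℝ) :
    ∫ y, F' y * (Real.sign (y - x) : ℂ) = -2 * F x := by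
  have hs : Integrable fun y => F' y * (Real.sign (y - x) : ℂ) := by
    exact (hi'.bdd_mul (f := fun y => (Real.sign (y - x) : ℂ))
      (Complex.measurable_ofReal.comp (measurable_sign_real.comp
        (measurable_id.sub_const x))).aestronglyMeasurable
      (Eventually.of_forall fun y => norm_sign_le_one (y - x))).congr
      (Eventually.of_forall fun y => mul_comm _ _)
  have hr : ∫ y in Set.Ioi x, F' y * (Real.sign (y - x) : ℂ) = -F x := by
    rw [setIntegral_congr_fun (g := F') measurableSet_Ioi fun y hy => by
      simp [Real.sign_of_pos (sub_pos.mpr (Set.mem_Ioi.mp hy))]]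
    rw [integral_Ioi_of_hasDerivAt_of_tendsto' (fun y _ => hF y) hi'.integrableOn
      (tendsto_zero_of_hasDerivAt_of_integrableOn_Ioi (a := x) (fun y _ => hF y)
        hi'.integrableOn hi.integrableOn), zero_sub]
  have hl : ∫ y in Set.Iic x, F' y * (Real.sign (y - x) : ℂ) = -F x := by
    rw [integral_Iic_eq_integral_Iio,
      setIntegral_congr_fun (g := fun y => -F' y) measurableSet_Iio fun y hy => by
        simp [Real.sign_of_neg (sub_neg.mpr (Set.mem_Iio.mp hy))],
      integral_neg, ← integral_Iic_eq_integral_Iio,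
      integral_Iic_of_hasDerivAt_of_tendsto' (fun y _ => hF y) hi'.integrableOn
      (tendsto_zero_of_hasDerivAt_of_integrableOn_Iic (a := x) (fun y _ => hF y)
        hi'.integrableOn hi.integrableOn), sub_zero]
  rw [← intervalIntegral.integral_Iic_add_Ioi (b := x) hs.integrableOn hs.integrableOn, hl, hr]
  ring

theorem skewInnerReal_neg_gaussDeriv (f h : ℂ[X]) :
    skewInnerReal 0 f (-gaussDeriv h) = 2 * ∫ x : ℝ, gaussPair f h x 0 := by
  have hd (y : ℝ) : HasDerivAt (fun y : ℝ => (Real.exp (-(1 / 2) * y ^ 2) : ℂ) * h.eval (y : ℂ))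
      ((Real.exp (-(1 / 2) * y ^ 2) : ℂ) * (gaussDeriv h).eval (y : ℂ)) y := by
    have he : HasDerivAt (fun y : ℝ => -(1 / 2) * y ^ 2) (-(1 / 2) * (2 * y)) y := by
      simpa using (hasDerivAt_pow 2 y).const_mul (-(1 / 2 : ℝ))
    refine (he.exp.ofReal_comp.mul (h.hasDerivAt (y : ℂ)).comp_ofReal).congr_deriv ?_
    simp only [gaussDeriv, Polynomial.eval_sub, Polynomial.eval_mul, Polynomial.eval_X]
    push_cast
    ring
  rw [skewInnerReal, ← integral_const_mul]
  refine integral_congr_ae (Eventually.of_forall fun x => ?_)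
  have hp (y : ℝ) : realIntegrand 0 f (-gaussDeriv h) x y =
      -((Real.exp (-(1 / 2) * x ^ 2) : ℂ) * f.eval (x : ℂ)) *
        ((Real.exp (-(1 / 2) * y ^ 2) : ℂ) * (gaussDeriv h).eval (y : ℂ)
          * (Real.sign (y - x) : ℂ)) := by
    have he : -(x ^ 2 + y ^ 2) / (2 * (1 + 0)) = -(1 / 2) * x ^ 2 + -(1 / 2) * y ^ 2 := by ring
    simp only [realIntegrand, he, Real.exp_add, Polynomial.eval_neg]
    push_cast
    ring
  have he : Real.exp (-x ^ 2) = Real.exp (-(1 / 2) * x ^ 2) * Real.exp (-(1 / 2) * x ^ 2) := by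
    rw [← Real.exp_add]; ring_nf
  simp only [hp]
  rw [integral_const_mul, integral_deriv_mul_sign hd
    (integrable_exp_neg_mul_sq_mul_eval (by norm_num) h)
    (integrable_exp_neg_mul_sq_mul_eval (by norm_num) _), gaussPair_zero_snd, he]
  push_cast
  ring

/-- The erfc factor is constant in x, so each horizontal line carries the integral of a total
derivative. -/
theorem integral_erfc_mul_deriv_fst {G G' : ℝ → ℝ → ℂ}
    (hG : ∀ x y, HasDerivAt (fun x => G x y) (G' x y) x)
    (hi : Integrable (fun z : ℝ × ℝ => (erfc (√2 * z.2) : ℂ) * G z.1 z.2)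
      (volume.prod (volume.restrict (Set.Ioi 0))))
    (hi' : Integrable (fun z : ℝ × ℝ => (erfc (√2 * z.2) : ℂ) * G' z.1 z.2)
      (volume.prod (volume.restrict (Set.Ioi 0)))) :
    ∫ x : ℝ, ∫ y in Set.Ioi (0 : ℝ), (erfc (√2 * y) : ℂ) * G' x y = 0 := by
  rw [integral_integral_swap hi', ← integral_zero ℝ ℂ (μ := volume.restrict (Set.Ioi 0))]
  refine integral_congr_ae ?_
  filter_upwards [hi.prod_left_ae, hi'.prod_left_ae] with y h h'
  exact integral_eq_zero_of_hasDerivAt_of_integrable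
    (fun x => (hG x y).const_mul (erfc (√2 * y) : ℂ)) h' h

theorem integral_erfc_mul_deriv_snd {G G' : ℝ → ℂ} (hG : ∀ y, HasDerivAt G (G' y) y)
    (hi : IntegrableOn (fun y => (erfc (√2 * y) : ℂ) * G y) (Set.Ioi 0))
    (hi' : IntegrableOn (fun y => (erfc (√2 * y) : ℂ) * G' y) (Set.Ioi 0))
    (hi'' : IntegrableOn (fun y => (Real.exp (-(√2 * y) ^ 2) : ℂ) * G y) (Set.Ioi 0)) :
    ∫ y in Set.Ioi (0 : ℝ), (erfc (√2 * y) : ℂ) * G' y =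
      ((2 * √2 / √Real.pi : ℝ) : ℂ) *
        (∫ y in Set.Ioi (0 : ℝ), (Real.exp (-(√2 * y) ^ 2) : ℂ) * G y) - G 0 := by
  have hd (y : ℝ) : HasDerivAt (fun y => (erfc (√2 * y) : ℂ) * G y)
      ((erfc (√2 * y) : ℂ) * G' y - ((2 * √2 / √Real.pi : ℝ) : ℂ) *
        ((Real.exp (-(√2 * y) ^ 2) : ℂ) * G y)) y := by
    have he := ((hasDerivAt_erfc (√2 * y)).comp y
      ((hasDerivAt_id y).const_mul √2)).ofReal_comp
    refine (he.mul (hG y)).congr_deriv ?_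
    simp only [Function.comp_apply]
    push_cast
    ring
  have hint := hi'.sub (hi''.const_mul ((2 * √2 / √Real.pi : ℝ) : ℂ))
  have h := integral_Ioi_of_hasDerivAt_of_tendsto' (a := 0) (fun y _ => hd y) hint
    (tendsto_zero_of_hasDerivAt_of_integrableOn_Ioi (a := 0) (fun y _ => hd y) hint hi)
  rw [integral_sub hi' (hi''.const_mul _), integral_const_mul] at h
  simp only [mul_zero, erfc_zero, Complex.ofReal_one, one_mul] at h
  linear_combination h

/-- The integrand is half an x-derivative (of an antisymmetric combination, integrating to 0) plus
-i/2 times a y-derivative of the symmetric sum of `gaussPair f h` and `gaussPair h f`. The prefactor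
2i turns -i/2 into 1. -/
theorem skewInnerComplex_neg_gaussDeriv (f h : ℂ[X]) :
    skewInnerComplex 0 f (-gaussDeriv h) =
      ((2 * √2 / √Real.pi : ℝ) : ℂ) *
        (∫ x : ℝ, ∫ y : ℝ, (Real.exp (-(√2 * y) ^ 2) : ℂ) * gaussPair f h x y)
      - 2 * ∫ x : ℝ, gaussPair f h x 0 := by
  have hE (a b : ℂ[X]) := integrable_erfc_mul_gaussPair a b
  have hU (x y : ℝ) := (hasDerivAt_gaussPair_fst h f x y).sub (hasDerivAt_gaussPair_fst f h x y)
  have hS (x y : ℝ) := (hasDerivAt_gaussPair_snd f h x y).add (hasDerivAt_gaussPair_snd h f x y)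
  set U' : ℝ → ℝ → ℂ := fun x y =>
    gaussPair (gaussDeriv h) f x y + gaussPair h (gaussDeriv f) x y
      - (gaussPair (gaussDeriv f) h x y + gaussPair f (gaussDeriv h) x y) with hU'
  set S' : ℝ → ℝ → ℂ := fun x y =>
    Complex.I * (gaussPair (gaussDeriv f) h x y - gaussPair f (gaussDeriv h) x y)
      + Complex.I * (gaussPair (gaussDeriv h) f x y - gaussPair h (gaussDeriv f) x y) with hS'
  have hiU' : Integrable (fun z : ℝ × ℝ => (erfc (√2 * z.2) : ℂ) * U' z.1 z.2)
      (volume.prod (volume.restrict (Set.Ioi 0))) :=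
    (((hE (gaussDeriv h) f).add (hE h (gaussDeriv f))).sub
      ((hE (gaussDeriv f) h).add (hE f (gaussDeriv h)))).congr
      (Eventually.of_forall fun z => by simp only [hU', Pi.add_apply, Pi.sub_apply]; ring)
  have hiS' : Integrable (fun z : ℝ × ℝ => (erfc (√2 * z.2) : ℂ) * S' z.1 z.2)
      (volume.prod (volume.restrict (Set.Ioi 0))) :=
    ((((hE (gaussDeriv f) h).sub (hE f (gaussDeriv h))).add
      ((hE (gaussDeriv h) f).sub (hE h (gaussDeriv f)))).const_mul Complex.I).congr
      (Eventually.of_forall fun z => by simp only [hS', Pi.add_apply, Pi.sub_apply]; ring)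
  have hiU : Integrable (fun z : ℝ × ℝ => (erfc (√2 * z.2) : ℂ) *
      (gaussPair h f z.1 z.2 - gaussPair f h z.1 z.2))
      (volume.prod (volume.restrict (Set.Ioi 0))) :=
    ((hE h f).sub (hE f h)).congr
      (Eventually.of_forall fun z => by simp only [Pi.sub_apply]; ring)
  have hiS : Integrable (fun z : ℝ × ℝ => (erfc (√2 * z.2) : ℂ) *
      (gaussPair f h z.1 z.2 + gaussPair h f z.1 z.2))
      (volume.prod (volume.restrict (Set.Ioi 0))) :=
    ((hE f h).add (hE h f)).congr
      (Eventually.of_forall fun z => by simp only [Pi.add_apply]; ring)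
  have hsum (x y : ℝ) : complexIntegrand 0 f (-gaussDeriv h) x y =
      1 / 2 * ((erfc (√2 * y) : ℂ) * U' x y)
        + -(Complex.I / 2) * ((erfc (√2 * y) : ℂ) * S' x y) := by
    simp only [complexIntegrand_zero_eq, gaussPair_neg_left, gaussPair_neg_right, hU', hS']
    linear_combination (1 / 2) * (erfc (√2 * y) : ℂ) *
      (gaussPair (gaussDeriv f) h x y - gaussPair f (gaussDeriv h) x y
      + (gaussPair (gaussDeriv h) f x y - gaussPair h (gaussDeriv f) x y)) * Complex.I_sq
  have hfull := integrable_exp_mul_gaussPair f h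
  have hSint : (fun x : ℝ => ∫ y in Set.Ioi (0 : ℝ), (erfc (√2 * y) : ℂ) * S' x y) =ᵐ[volume]
      fun x => ((2 * √2 / √Real.pi : ℝ) : ℂ) *
        (∫ y : ℝ, (Real.exp (-(√2 * y) ^ 2) : ℂ) * gaussPair f h x y)
        - 2 * gaussPair f h x 0 := by
    filter_upwards [hiS.prod_right_ae, hiS'.prod_right_ae, hfull.prod_right_ae,
      (integrable_exp_mul_gaussPair h f).prod_right_ae] with x h1 h2 h3 h4
    have h5 : IntegrableOn (fun y : ℝ => (Real.exp (-(√2 * y) ^ 2) : ℂ) *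
        (gaussPair f h x y + gaussPair h f x y)) (Set.Ioi 0) := by
      simp only [mul_add]
      exact (h3.add h4).integrableOn
    -- The reflection y ↦ -y swaps the two polynomials, so the symmetric sum over the upper
    -- half-line unfolds to the whole line.
    have h6 : ∫ y in Set.Ioi (0 : ℝ), (Real.exp (-(√2 * y) ^ 2) : ℂ) * gaussPair h f x y =
        ∫ y in Set.Iic (0 : ℝ), (Real.exp (-(√2 * y) ^ 2) : ℂ) * gaussPair f h x y := by
      rw [← neg_zero, ← integral_comp_neg_Ioi, neg_zero]
      simp only [gaussPair_neg_snd, mul_neg, neg_sq]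
    have h7 := integral_erfc_mul_deriv_snd (hS x) h1 h2 h5
    refine h7.trans ?_
    simp only [Pi.add_apply, mul_add]
    rw [integral_add h3.integrableOn h4.integrableOn, h6, add_comm (∫ y in Set.Ioi (0 : ℝ), _),
      intervalIntegral.integral_Iic_add_Ioi h3.integrableOn h3.integrableOn,
      gaussPair_zero_snd, gaussPair_zero_snd]
    ring
  have hb : Integrable fun x : ℝ => gaussPair f h x 0 := by
    simpa [gaussPair_zero_snd] using
      integrable_exp_neg_mul_sq_mul_eval (b := 1) one_pos (f * h)
  rw [skewInnerComplex]
  simp only [hsum]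
  rw [integral_integral_add (hiU'.const_mul _) (hiS'.const_mul _)]
  simp only [integral_const_mul]
  rw [integral_erfc_mul_deriv_fst hU hiU hiU', integral_congr_ae hSint,
    integral_sub (hfull.integral_prod_left.const_mul _) (hb.const_mul 2), integral_const_mul,
    integral_const_mul]
  linear_combination -(((2 * √2 / √Real.pi : ℝ) : ℂ) *
        (∫ x : ℝ, ∫ y : ℝ, (Real.exp (-(√2 * y) ^ 2) : ℂ) * gaussPair f h x y)
      - 2 * ∫ x : ℝ, gaussPair f h x 0) * Complex.I_sq

theorem integral_exp_mul_gaussPair (f h : ℂ[X]) :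
    ∫ x : ℝ, ∫ y : ℝ, (Real.exp (-(√2 * y) ^ 2) : ℂ) * gaussPair f h x y =
      ∫ z : ℂ, (Real.exp (-‖z‖ ^ 2) : ℂ) * (f.eval z * h.eval (starRingEnd ℂ z)) := by
  rw [integral_integral (integrable_exp_mul_gaussPair f h), ← Measure.volume_eq_prod,
    ← Complex.volume_preserving_equiv_real_prod.integral_comp
      Complex.measurableEquivRealProd.measurableEmbedding]
  refine integral_congr_ae (Eventually.of_forall fun z => ?_)
  have h1 : (z.re : ℂ) + Complex.I * z.im = z := by rw [mul_comm]; exact Complex.re_add_im z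
  have h2 : (z.re : ℂ) - Complex.I * z.im = starRingEnd ℂ z := by
    apply Complex.ext <;> simp
  have h3 : z.re ^ 2 + z.im ^ 2 = ‖z‖ ^ 2 := by
    rw [Complex.sq_norm, Complex.normSq_apply]; ring
  simp only [Complex.measurableEquivRealProd_apply, exp_mul_gaussPair, h1, h2, h3]

theorem skewInner_neg_gaussDeriv (f h : ℂ[X]) :
    skewInner 0 f (-gaussDeriv h) = ((2 * √2 / √Real.pi : ℝ) : ℂ) *
      ∫ z : ℂ, (Real.exp (-‖z‖ ^ 2) : ℂ) * (f.eval z * h.eval (starRingEnd ℂ z)) := by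
  rw [skewInner, skewInnerReal_neg_gaussDeriv, skewInnerComplex_neg_gaussDeriv,
    integral_exp_mul_gaussPair]
  ring

/-! ### Parity and Gaussian moments. -/

/-- The map (x, y) ↦ (-x, -y) reverses sgn(y - x). In the complex half z ↦ -z̄ preserves the upper
half-plane and exchanges the two bracketed terms. -/
theorem skewInner_eq_zero_of_parity {f g : ℂ[X]} {s : ℂ} (hs : s * s = 1)
    (hf : ∀ z, f.eval (-z) = s * f.eval z) (hg : ∀ z, g.eval (-z) = s * g.eval z) :
    skewInner 0 f g = 0 := by
  have hr : skewInnerReal 0 f g = 0 := by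
    rw [skewInnerReal, ← self_eq_neg, ← integral_neg]
    rw [← integral_neg_eq_self]
    refine integral_congr_ae (Eventually.of_forall fun x => ?_)
    dsimp only
    rw [← integral_neg, ← integral_neg_eq_self]
    refine integral_congr_ae (Eventually.of_forall fun y => ?_)
    simp only [realIntegrand, Complex.ofReal_neg, hf, hg, neg_sq]
    rw [show -y - -x = -(y - x) by ring, Real.sign_neg, Complex.ofReal_neg]
    linear_combination -((Real.exp (-(x ^ 2 + y ^ 2) / (2 * (1 + 0))) : ℂ) * f.eval (x : ℂ)
      * g.eval (y : ℂ) * (Real.sign (y - x) : ℂ)) * hs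
  have hc : skewInnerComplex 0 f g = 0 := by
    rw [skewInnerComplex, mul_eq_zero]
    right
    rw [← self_eq_neg, ← integral_neg]
    rw [← integral_neg_eq_self]
    refine integral_congr_ae (Eventually.of_forall fun x => ?_)
    dsimp only
    rw [← integral_neg]
    refine integral_congr_ae (Eventually.of_forall fun y => ?_)
    simp only [complexIntegrand_zero_eq, gaussPair, Complex.ofReal_neg, neg_sq]
    rw [show -(x : ℂ) + Complex.I * y = -((x : ℂ) - Complex.I * y) by ring,
      show -(x : ℂ) - Complex.I * y = -((x : ℂ) + Complex.I * y) by ring]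
    simp only [hf, hg]
    linear_combination (erfc (√2 * y) : ℂ) * (Real.exp (y ^ 2 - x ^ 2) : ℂ)
      * (f.eval ((x : ℂ) - Complex.I * y) * g.eval ((x : ℂ) + Complex.I * y)
        - g.eval ((x : ℂ) - Complex.I * y) * f.eval ((x : ℂ) + Complex.I * y)) * hs
  rw [skewInner, hr, hc, add_zero]

theorem integral_pow_mul_conj_pow_eq_zero {a b : ℕ} (hab : a ≠ b) :
    ∫ z : ℂ, (Real.exp (-‖z‖ ^ 2) : ℂ) * (z ^ a * starRingEnd ℂ z ^ b) = 0 := by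
  have hd : ((a : ℂ) - b) ≠ 0 := sub_ne_zero.mpr (by exact_mod_cast hab)
  -- Rotation by π/(a - b) multiplies z^a z̄^b by -1.
  set c : Circle := Circle.exp (Real.pi / ((a : ℝ) - b)) with hc
  have hcc : (c : ℂ) ^ a * starRingEnd ℂ (c : ℂ) ^ b = -1 := by
    rw [hc, Circle.coe_exp, ← Complex.exp_conj, ← Complex.exp_nat_mul, ← Complex.exp_nat_mul,
      ← Complex.exp_add, ← Complex.exp_pi_mul_I]
    congr 1
    simp only [map_mul, Complex.conj_I, Complex.conj_ofReal]
    push_cast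
    field_simp
    ring
  rw [← self_eq_neg, ← integral_neg,
    ← (rotation c).measurePreserving.integral_comp
      (rotation c).toHomeomorph.measurableEmbedding]
  refine integral_congr_ae (Eventually.of_forall fun z => ?_)
  simp only [rotation_apply, map_mul, mul_pow, norm_mul, Circle.norm_coe, one_mul]
  linear_combination (Real.exp (-‖z‖ ^ 2) : ℂ) * (z ^ a * starRingEnd ℂ z ^ b) * hcc

theorem integral_pow_mul_conj_pow_self (n : ℕ) :
    ∫ z : ℂ, (Real.exp (-‖z‖ ^ 2) : ℂ) * (z ^ n * starRingEnd ℂ z ^ n) =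
      ((Real.pi * n.factorial : ℝ) : ℂ) := by
  have h := integral_norm_pow_mul_exp_neg_norm_sq (2 * n)
  rw [show (((2 * n : ℕ) : ℝ) + 2) / 2 = n + 1 by push_cast; ring,
    Real.Gamma_nat_eq_factorial] at h
  rw [← h, ← integral_complex_ofReal]
  refine integral_congr_ae (Eventually.of_forall fun z => ?_)
  simp only [← mul_pow, Complex.mul_conj, Complex.normSq_eq_norm_sq]
  push_cast
  ring

/-! ### The skew orthogonal family. -/

theorem neg_gaussDeriv_X_pow (m : ℕ) :
    -gaussDeriv (Polynomial.X ^ m) =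
      Polynomial.X ^ (m + 1) - Polynomial.C (m : ℂ) * Polynomial.X ^ (m - 1) := by
  rw [gaussDeriv, Polynomial.derivative_X_pow]
  ring

theorem corollary1 (p : ℕ → Polynomial ℂ)
    (heven : ∀ n : ℕ, p (2 * n) = Polynomial.X ^ (2 * n))
    (hodd : ∀ n : ℕ, p (2 * n + 1) =
      Polynomial.X ^ (2 * n + 1)
        - Polynomial.C (2 * (n : ℂ)) * Polynomial.X ^ (2 * n - 1)) :
    (∀ j : ℕ, (p j).Monic ∧ (p j).natDegree = j) ∧
    (∀ f g : Polynomial ℂ, SkewInnerConverges 0 f g) ∧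
    IsSkewOrthogonal (skewInner 0) p ∧
    (∀ n : ℕ, skewInner 0 (p (2 * n)) (p (2 * n + 1)) =
      (((Nat.factorial (2 * n) : ℝ) * (2 * Real.sqrt (2 * Real.pi)) : ℝ) : ℂ)) := by
  -- At n = 0 the exponent 2n - 1 truncates to 0, harmlessly, since its coefficient vanishes.
  have hodd' (n : ℕ) : p (2 * n + 1) = -gaussDeriv (Polynomial.X ^ (2 * n)) := by
    rw [hodd, neg_gaussDeriv_X_pow]
    push_cast
    rfl
  have hevenodd (j k : ℕ) : skewInner 0 (p (2 * j)) (p (2 * k + 1)) =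
      ((2 * √2 / √Real.pi : ℝ) : ℂ) *
        ∫ z : ℂ, (Real.exp (-‖z‖ ^ 2) : ℂ) * (z ^ (2 * j) * starRingEnd ℂ z ^ (2 * k)) := by
    rw [heven, hodd', skewInner_neg_gaussDeriv]
    simp only [Polynomial.eval_pow, Polynomial.eval_X]
  have hnorm (n : ℕ) : skewInner 0 (p (2 * n)) (p (2 * n + 1)) =
      (((Nat.factorial (2 * n) : ℝ) * (2 * Real.sqrt (2 * Real.pi)) : ℝ) : ℂ) := by
    rw [hevenodd, integral_pow_mul_conj_pow_self, ← Complex.ofReal_mul, Complex.ofReal_inj,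
      Real.sqrt_mul (by norm_num)]
    have hpi : √Real.pi ≠ 0 := by positivity
    field_simp
    linear_combination -Real.sq_sqrt Real.pi_pos.le
  have hdeg (n : ℕ) : (Polynomial.C (2 * (n : ℂ)) * Polynomial.X ^ (2 * n - 1)).degree <
      (Polynomial.X ^ (2 * n + 1) : ℂ[X]).degree := by
    rw [Polynomial.degree_X_pow]
    exact (Polynomial.degree_C_mul_X_pow_le _ _).trans_lt (Nat.cast_lt.mpr (by omega))
  have hparity (n : ℕ) (z : ℂ) : (p (2 * n + 1)).eval (-z) = -1 * (p (2 * n + 1)).eval z := by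
    rw [hodd]
    rcases n with _ | n
    · simp
    · have h1 : Odd (2 * (n + 1) + 1) := ⟨n + 1, rfl⟩
      have h2 : Odd (2 * (n + 1) - 1) := ⟨n, by omega⟩
      simp only [Polynomial.eval_sub, Polynomial.eval_mul, Polynomial.eval_pow,
        Polynomial.eval_X, Polynomial.eval_C, h1.neg_pow, h2.neg_pow]
      ring
  refine ⟨fun j => ?_, skewInnerConverges_zero, ⟨fun j k => ?_, fun j k => ?_, fun j k hjk => ?_,
    fun j => ?_⟩, hnorm⟩
  · obtain ⟨n, rfl | rfl⟩ := Nat.even_or_odd' j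
    · rw [heven]
      exact ⟨Polynomial.monic_X_pow _, Polynomial.natDegree_X_pow _⟩
    · rw [hodd]
      exact ⟨(Polynomial.monic_X_pow _).sub_of_left (hdeg n),
        Polynomial.natDegree_eq_of_degree_eq_some
          ((Polynomial.degree_sub_eq_left_of_degree_lt (hdeg n)).trans
            (Polynomial.degree_X_pow _))⟩
  · refine skewInner_eq_zero_of_parity (s := 1) (by norm_num) ?_ ?_ <;> intro z <;>
      simp [heven, (even_two_mul _).neg_pow]
  · exact skewInner_eq_zero_of_parity (s := -1) (by norm_num) (hparity j) (hparity k)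
  · rw [hevenodd, integral_pow_mul_conj_pow_eq_zero (by omega), mul_zero]
  · rw [hnorm, Complex.ofReal_ne_zero]
    positivity
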